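/- Let $\sigma>0$ be known and let $X_1,X_2,\dots$ be i.i.d. real random variables with $E[X_1^2]<\infty$ whose common distribution is absolutely continuous with respect to Lebesgue measure. This covers in particular the atomic deconvolution model $X_i=Y_i+\sigma Z_i$, $Y_i=U_iV_i$, where $Y_i$ and the standard normal variable $Z_i$ are independent, $U_i$ and $V_i$ are independent, $P(U_i=0)=p$, $P(U_i=1)=1-p$ with $0\le p<1$, and $V_i$ has a density $f$; this case is part of the claim. Let $\phi_w:\mathbb R\to\mathbb R$ (the Fourier transform of the kernel $w$) be measurable, bounded, symmetric, supported in $[-1,1]$, with $\phi_w(0)=1$ and $$\phi_w(1-t)=At^\alpha+o(t^\alpha)\quad\text{as } t\downarrow 0$$ for some constants $A\in\mathbb R$ and $\alpha\ge 0$. Let $h=h_n>0$ with $h_n\to0$ as $n\to\infty$, and let $x\in\mathbb R$ be fixed. Define $$\hat f_{nh}(x)=\frac1{2\pi}\int_{-\infty}^\infty e^{-itx}\,\frac{\phi_{emp}(t)\,\phi_w(ht)}{e^{-\sigma^2t^2/2}}\,dt,\qquad \phi_{emp}(t)=\frac1n\sum_{j=1}^n e^{itX_j}.$$ Then $\hat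 f_{nh}(x)$ is real valued and integrable, and as $n\to\infty$ $$\frac{\sqrt n}{h^{1+2\alpha}e^{\sigma^2/(2h^2)}}\bigl(\hat f_{nh}(x)-E[\hat f_{nh}(x)]\bigr)\xrightarrow{\mathcal D}N\!\left(0,\frac{A^2\,\Gamma(\alpha+1)^2}{2\pi^2}\left(\frac1{\sigma^2}\right)^{2+2\alpha}\right),$$ where $N(0,0)$ denotes the unit mass at $0$ (the case $A=0$). -/

import Mathlib

open MeasureTheory ProbabilityTheory Filter Topology Asymptotics

noncomputable section

/-- The conditions on the Fourier transform `φ` of the kernel `w`: `φ` is a bounded, real valued,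
symmetric function supported in `[-1, 1]` with `φ 0 = 1` and
`φ (1 - t) = A t ^ α + o(t ^ α)` as `t ↓ 0`, for a constant `A` and an exponent `α ≥ 0`.
Every such (measurable) `φ` is the Fourier transform of the square integrable kernel
`w x = (2 π)⁻¹ ∫ exp (-i t x) φ t dt`. -/
structure KernelCondition (φ : ℝ → ℝ) (A α : ℝ) : Prop where
  measurable : Measurable φ
  bounded : ∃ C : ℝ, ∀ t, |φ t| ≤ C
  symmetric : ∀ t, φ (-t) = φ t
  support_subset : Function.support φ ⊆ Set.Icc (-1) 1
  map_zero : φ 0 = 1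
  alpha_nonneg : 0 ≤ α
  expansion : (fun t : ℝ => φ (1 - t) - A * t ^ α) =o[𝓝[>] 0] (fun t : ℝ => t ^ α)

/-- The random variable `X` is an observation in the atomic deconvolution model:
`X = Y + σ Z` with `Y = U V` independent of the standard normal variable `Z`, where `U` and `V` are
independent, `U` is Bernoulli with `P (U = 0) = p`, `P (U = 1) = 1 - p`, `0 ≤ p < 1`,
and `V` has density `f`. -/
def IsAtomicObservation {Ω : Type*} [MeasurableSpace Ω] (P : Measure Ω) (σ p : ℝ) (f : ℝ → ℝ)
    (X : Ω → ℝ) : Prop :=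
  0 ≤ p ∧ p < 1 ∧ Measurable f ∧ (∀ v, 0 ≤ f v) ∧
  ∃ U V Z : Ω → ℝ,
    HasLaw U (ENNReal.ofReal p • Measure.dirac 0 + ENNReal.ofReal (1 - p) • Measure.dirac 1) P ∧
    HasLaw V (volume.withDensity (fun v => ENNReal.ofReal (f v))) P ∧
    HasLaw Z (gaussianReal 0 1) P ∧
    IndepFun U V P ∧
    IndepFun (fun ω => U ω * V ω) Z P ∧
    ∀ᵐ ω ∂P, X ω = U ω * V ω + σ * Z ω

/-- The empirical characteristic function `n⁻¹ ∑_{j < n} exp (i t x_j)` of the sample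
`x_0, …, x_{n-1}`. -/
def empiricalCharFun (n : ℕ) (x : ℕ → ℝ) (t : ℝ) : ℂ :=
  (1 / (n : ℂ)) * ∑ j ∈ Finset.range n, Complex.exp (Complex.I * t * x j)

/-- The classical deconvolution kernel density estimator at the point `x₀`, with bandwidth `h`,
based on the sample `x_0, …, x_{n-1}` and Gaussian errors of standard deviation `σ`:
`(2 π)⁻¹ ∫ exp (-i t x₀) φ_emp(t) φ(h t) / exp (-σ² t² / 2) dt`. -/
def deconvEstimator (σ : ℝ) (φ : ℝ → ℝ) (n : ℕ) (h : ℝ) (x : ℕ → ℝ) (x₀ : ℝ) : ℂ :=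
  (1 / (2 * Real.pi : ℂ)) *
    ∫ t : ℝ, Complex.exp (-(Complex.I * t * x₀)) *
      (empiricalCharFun n x t * (φ (h * t) : ℂ) / (Real.exp (-(σ ^ 2 * t ^ 2 / 2)) : ℂ))

end

/-!
The estimator is the sample mean of `K_h (X j - x₀)`, where `K_h` is the deconvolution kernel
`K_h u = (2 π)⁻¹ ∫ cos (t u) φ (h t) exp (σ² t² / 2) dt` (`deconvEstimator_eq_mean`). The factor
`exp (σ² t² / 2)` concentrates the integral at the edges `t = ± 1 / h` of the support of `φ (h t)`.
Zooming in on an edge with `t = 1 / h - h y`, the exponential becomes `exp (σ² / (2 h²) - σ² y)` up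
to a factor tending to `1`, while `φ (h t) = φ (1 - h² y)` behaves like `A (h² y) ^ α`. By dominated
convergence, with `∫ y ^ α exp (-σ² y) dy = Γ(α + 1) σ ^ (-2 (α + 1))`, the kernel divided by
`h ^ (1 + 2 α) exp (σ² / (2 h²))` is bounded uniformly in `u` and `h`, and differs from
`κ cos (u / h)`, `κ = A Γ(α + 1) σ ^ (-2 (α + 1)) / π`, by a term that tends to `0` for every `u`
(`KernelCondition.deconvKernel_div_asymptotics`).

The law of the observations is absolutely continuous, in the atomic model because of the Gaussian
error (`IsAtomicObservation.map_absolutelyContinuous`). As the frequency `1 / h` tends to infinity,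
the Riemann–Lebesgue lemma shows that the mean and the second moment of the normalised summands tend
to `0` and `κ² / 2` (`tendsto_integral_of_asymptotically_cos`). The summands are uniformly bounded,
so a central limit theorem for triangular arrays, obtained from a Taylor expansion of characteristic
functions and Lévy's theorem (`tendstoInDistribution_inv_sqrt_mul_sum_of_bounded_array`), gives the
limit `N(0, κ² / 2)`.
-/

/-! ### Oscillating integrals against absolutely continuous laws -/

/-- Riemann–Lebesgue lemma for absolutely continuous measures. -/
theorem tendsto_charFun_cocompact_of_absolutelyContinuous {μ : Measure ℝ} [IsFiniteMeasure μ]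
    (hμ : μ ≪ volume) : Tendsto (charFun μ) (cocompact ℝ) (𝓝 0) := by
  have hRL := Real.tendsto_integral_exp_smul_cocompact
    (fun x : ℝ => (((μ.rnDeriv volume x).toReal : ℝ) : ℂ))
  have hscale : Tendsto (fun s : ℝ => s * (-(2 * Real.pi))⁻¹) (cocompact ℝ) (cocompact ℝ) :=
    (Homeomorph.mulRight₀ ((-(2 * Real.pi))⁻¹)
      (inv_ne_zero (neg_ne_zero.2 (by positivity)))).isClosedEmbedding.tendsto_cocompact
  refine (hRL.comp hscale).congr fun s => ?_
  rw [charFun_apply_real, ← integral_rnDeriv_smul hμ]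
  refine integral_congr_ae (.of_forall fun x => ?_)
  simp only [Circle.smul_def, Real.fourierChar_apply, smul_eq_mul, Complex.real_smul]
  rw [mul_comm]
  congr 2
  push_cast
  field_simp

theorem tendsto_integral_cos_of_absolutelyContinuous {μ : Measure ℝ} [IsFiniteMeasure μ]
    (hμ : μ ≪ volume) (x₀ : ℝ) {s : ℕ → ℝ} (hs : Tendsto s atTop atTop) :
    Tendsto (fun n => ∫ x, Real.cos (s n * (x - x₀)) ∂μ) atTop (𝓝 0) := by
  have hc : Tendsto (fun n => charFun μ (s n)) atTop (𝓝 0) :=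
    (tendsto_charFun_cocompact_of_absolutelyContinuous hμ).comp
      (hs.mono_right atTop_le_cocompact)
  refine squeeze_zero_norm (fun n => ?_) (tendsto_zero_iff_norm_tendsto_zero.1 hc)
  have hre : ∫ x, Real.cos (s n * (x - x₀)) ∂μ =
      (Complex.exp (((-(s n * x₀) : ℝ) : ℂ) * Complex.I) * charFun μ (s n)).re := by
    rw [charFun_apply_real, ← integral_const_mul]
    have hint : Integrable (fun x : ℝ => Complex.exp (((-(s n * x₀) : ℝ) : ℂ) * Complex.I) *
        Complex.exp (s n * x * Complex.I)) μ := by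
      refine Integrable.of_bound (C := 1) (by fun_prop) (.of_forall fun x => ?_)
      rw [norm_mul, Complex.norm_exp_ofReal_mul_I, ← Complex.ofReal_mul,
        Complex.norm_exp_ofReal_mul_I, one_mul]
    have := integral_re hint
    simp only [RCLike.re_eq_complex_re] at this
    rw [← this]
    refine integral_congr_ae (.of_forall fun x => ?_)
    simp only
    rw [← Complex.exp_add, ← Complex.exp_ofReal_mul_I_re]
    congr 2
    push_cast
    ring
  rw [hre]
  refine (Complex.abs_re_le_norm _).trans ?_
  rw [norm_mul, Complex.norm_exp_ofReal_mul_I, one_mul]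

/-- The atomic deconvolution model has an absolutely continuous law, even though `Y = U V` may have
an atom at `0`: convolution with the Gaussian law of `σ Z` smooths every law. -/
theorem IsAtomicObservation.map_absolutelyContinuous {Ω : Type*} [MeasurableSpace Ω]
    {P : Measure Ω} [IsProbabilityMeasure P] {σ p : ℝ} {f : ℝ → ℝ} {X : Ω → ℝ}
    (hX : IsAtomicObservation P σ p f X) (hσ : σ ≠ 0) : P.map X ≪ volume := by
  obtain ⟨-, -, -, -, U, V, Z, hU, hV, hZ, -, hYZ, hXeq⟩ := hX
  have hY : AEMeasurable (fun ω => U ω * V ω) P := hU.aemeasurable.mul hV.aemeasurable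
  have hYlaw : HasLaw (fun ω => U ω * V ω) (P.map fun ω => U ω * V ω) P := ⟨hY, rfl⟩
  have := Measure.isProbabilityMeasure_map hY
  have hZlaw := gaussianReal_const_mul hZ σ
  have hind : IndepFun (fun ω => U ω * V ω) (fun ω => σ * Z ω) P :=
    hYZ.comp (φ := id) (ψ := fun z => σ * z) measurable_id (by fun_prop)
  have hsum := hind.hasLaw_fun_add hYlaw hZlaw
  rw [Measure.map_congr hXeq, hsum.map_eq]
  refine Measure.conv_absolutelyContinuous (gaussianReal_absolutelyContinuous _ ?_)
  simpa [← NNReal.coe_inj] using hσ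

/-! ### A central limit theorem for bounded triangular arrays -/

theorem norm_cexp_mul_I_sub_taylor_two_le {z : ℝ} (hz : |z| ≤ 1) :
    ‖Complex.exp (z * Complex.I) - (1 + z * Complex.I - (z ^ 2 / 2 : ℝ))‖ ≤ |z| ^ 3 := by
  have hn : ‖(z : ℂ) * Complex.I‖ = |z| := by simp
  have h := Complex.exp_bound (x := z * Complex.I) (by rw [hn]; exact hz) (n := 3) (by norm_num)
  rw [hn] at h
  have hs : ∑ m ∈ Finset.range 3, ((z : ℂ) * Complex.I) ^ m / m.factorial =
      1 + z * Complex.I - (z ^ 2 / 2 : ℝ) := by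
    simp [Finset.sum_range_succ, mul_pow, Nat.factorial]
    ring
  rw [hs] at h
  refine h.trans (mul_le_of_le_one_right (by positivity) ?_)
  norm_num [Nat.factorial]

theorem norm_charFun_sub_taylor_two_le {Ω : Type*} [MeasurableSpace Ω] {P : Measure Ω}
    [IsProbabilityMeasure P] {D : Ω → ℝ} (hD : AEMeasurable D P) {C s : ℝ}
    (hDC : ∀ ω, |D ω| ≤ C) (hmean : ∫ ω, D ω ∂P = 0) (hs : |s| * C ≤ 1) :
    ‖charFun (P.map D) s - (1 - (s ^ 2 / 2 * ∫ ω, D ω ^ 2 ∂P : ℝ))‖ ≤ (|s| * C) ^ 3 := by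
  have hsD (ω : Ω) : |s * D ω| ≤ |s| * C := by
    rw [abs_mul]; exact mul_le_mul_of_nonneg_left (hDC ω) (abs_nonneg s)
  have hDint : Integrable D P :=
    .of_bound hD.aestronglyMeasurable C (.of_forall hDC)
  have hDsq : Integrable (fun ω => D ω ^ 2) P := by
    refine .of_bound (hD.pow_const 2).aestronglyMeasurable (C ^ 2) (.of_forall fun ω => ?_)
    rw [norm_pow]
    exact pow_le_pow_left₀ (norm_nonneg _) (hDC ω) 2
  have hexp : Integrable (fun ω => Complex.exp ((s * D ω : ℝ) * Complex.I)) P := by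
    refine .of_bound (by fun_prop) 1 (.of_forall fun ω => ?_)
    rw [Complex.norm_exp_ofReal_mul_I]
  have hlin : Integrable (fun ω => ((s * D ω : ℝ) : ℂ) * Complex.I) P :=
    (hDint.const_mul s).ofReal.mul_const _
  have hquad : Integrable (fun ω => (((s * D ω) ^ 2 / 2 : ℝ) : ℂ)) P := by
    refine Integrable.ofReal ?_
    simp_rw [mul_pow]
    exact (hDsq.const_mul _).div_const _
  have haff : Integrable (fun ω => 1 + ((s * D ω : ℝ) : ℂ) * Complex.I) P :=
    (integrable_const _).add hlin
  have hdiff : Integrable (fun ω =>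
      1 + ((s * D ω : ℝ) : ℂ) * Complex.I - ((s * D ω) ^ 2 / 2 : ℝ)) P := haff.sub hquad
  have hpoly : ∫ ω, (1 + ((s * D ω : ℝ) : ℂ) * Complex.I - ((s * D ω) ^ 2 / 2 : ℝ)) ∂P =
      1 - (s ^ 2 / 2 * ∫ ω, D ω ^ 2 ∂P : ℝ) := by
    rw [integral_sub haff hquad, integral_add (integrable_const _) hlin,
      integral_mul_const, integral_complex_ofReal, integral_complex_ofReal, integral_const_mul,
      hmean]
    simp_rw [mul_pow, mul_div_right_comm]
    rw [integral_const_mul]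
    simp
  have hchar : charFun (P.map D) s = ∫ ω, Complex.exp ((s * D ω : ℝ) * Complex.I) ∂P := by
    rw [charFun_apply_real, integral_map hD (by fun_prop)]
    simp
  rw [hchar, ← hpoly, ← integral_sub hexp hdiff]
  refine (norm_integral_le_of_norm_le_const (C := (|s| * C) ^ 3) (.of_forall fun ω => ?_)).trans
    (by simp)
  exact (norm_cexp_mul_I_sub_taylor_two_le ((hsD ω).trans hs)).trans
    (pow_le_pow_left₀ (abs_nonneg _) (hsD ω) 3)

/-- Central limit theorem for the triangular array `d n (X j)`, `j < n`, with uniformly bounded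
centred entries. The uniform bound makes the third order remainder of the characteristic function
of an entry at `t / √n` of size `O (n ^ (-3 / 2))`, uniformly in the row. The limiting variance may
vanish. -/
theorem tendstoInDistribution_inv_sqrt_mul_sum_of_bounded_array {Ω : Type*} [MeasurableSpace Ω]
    {P : Measure Ω} [IsProbabilityMeasure P] {X : ℕ → Ω → ℝ} (hindep : iIndepFun X P)
    (hident : ∀ i, IdentDistrib (X i) (X 0) P P) {d : ℕ → ℝ → ℝ} (hd : ∀ n, Measurable (d n))
    {C : ℝ} (hC : ∀ n x, |d n x| ≤ C) (hmean : ∀ n, ∫ ω, d n (X 0 ω) ∂P = 0) {v : NNReal}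
    (hvar : Tendsto (fun n => ∫ ω, d n (X 0 ω) ^ 2 ∂P) atTop (𝓝 v)) :
    TendstoInDistribution (fun (n : ℕ) ω => (√(n : ℝ))⁻¹ * ∑ j ∈ Finset.range n, d n (X j ω))
      atTop (id : ℝ → ℝ) (fun _ => P) (gaussianReal 0 v) where
  forall_aemeasurable n := .const_mul (Finset.aemeasurable_fun_sum _ fun j _ =>
    (hd n).comp_aemeasurable (hident j).aemeasurable_fst) _
  tendsto := by
    have hC0 : 0 ≤ C := (abs_nonneg _).trans (hC 0 0)
    refine ProbabilityMeasure.tendsto_iff_tendsto_charFun.2 fun t => ?_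
    have hX0 := (hident 0).aemeasurable_fst
    have hcf (n : ℕ) : charFun
        (P.map fun ω => (√(n : ℝ))⁻¹ * ∑ j ∈ Finset.range n, d n (X j ω)) t =
        (1 + (charFun (P.map fun ω => d n (X 0 ω)) ((√(n : ℝ))⁻¹ * t) - 1)) ^ n := by
      rw [add_sub_cancel]
      exact charFun_inv_sqrt_mul_sum (X := fun j ω => d n (X j ω))
        (hindep.comp (fun _ => d n) fun _ => hd n) fun i => (hident i).comp (hd n)
    simp only [ProbabilityMeasure.coe_mk, hcf, Measure.map_id, charFun_gaussianReal]
    refine Complex.tendsto_one_add_pow_exp_of_tendsto ?_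
    have hsq : Tendsto (fun n : ℕ => (√(n : ℝ))⁻¹) atTop (𝓝 0) :=
      tendsto_inv_atTop_zero.comp (Real.tendsto_sqrt_atTop.comp tendsto_natCast_atTop_atTop)
    have hmain : Tendsto (fun n : ℕ => ((-(t ^ 2 / 2 * ∫ ω, d n (X 0 ω) ^ 2 ∂P) : ℝ) : ℂ)) atTop
        (𝓝 ((t : ℂ) * (0 : ℝ) * Complex.I - (v : NNReal) * t ^ 2 / 2)) := by
      have := (Complex.continuous_ofReal.tendsto _).comp (hvar.const_mul (t ^ 2 / 2)).neg
      convert! this using 2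
      simp
      ring
    -- The remainder, multiplied by `n`, is at most `n * (|t| C / √n) ^ 3 = (|t| C) ^ 3 / √n`.
    refine tendsto_of_tendsto_of_dist hmain (squeeze_zero' (.of_forall fun _ => dist_nonneg)
      (g := fun n : ℕ => (|t| * C) ^ 3 * (√(n : ℝ))⁻¹) ?_ (by simpa using hsq.const_mul _))
    have hsmall : ∀ᶠ n : ℕ in atTop, |(√(n : ℝ))⁻¹ * t| * C ≤ 1 := by
      have : Tendsto (fun n : ℕ => |(√(n : ℝ))⁻¹ * t| * C) atTop (𝓝 0) := by
        simpa using ((hsq.mul_const t).abs.mul_const C)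
      exact this.eventually_le_const one_pos
    filter_upwards [hsmall, eventually_gt_atTop 0] with n hn hn0
    have hnpos : (0 : ℝ) < n := by exact_mod_cast hn0
    have hb := norm_charFun_sub_taylor_two_le ((hd n).comp_aemeasurable hX0)
      (fun ω => hC n (X 0 ω)) (hmean n) hn
    have hnC : (n : ℂ) ≠ 0 := by exact_mod_cast hn0.ne'
    have hsn : (√(n : ℝ))⁻¹ ^ 2 = (n : ℝ)⁻¹ := by
      rw [inv_pow, Real.sq_sqrt hnpos.le]
    rw [dist_comm, dist_eq_norm]
    calc _ = ‖(n : ℂ) * (charFun (P.map fun ω => d n (X 0 ω)) ((√(n : ℝ))⁻¹ * t) -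
          (1 - (((√(n : ℝ))⁻¹ * t) ^ 2 / 2 * ∫ ω, d n (X 0 ω) ^ 2 ∂P : ℝ)))‖ := by
          rw [mul_pow, hsn]
          push_cast
          congr 1
          field_simp
          ring
      _ ≤ n * (|(√(n : ℝ))⁻¹ * t| * C) ^ 3 := by
          rw [norm_mul, Complex.norm_natCast]
          exact mul_le_mul_of_nonneg_left hb hnpos.le
      _ = (|t| * C) ^ 3 * (√(n : ℝ))⁻¹ := by
          rw [abs_mul, abs_of_nonneg (by positivity : 0 ≤ (√(n : ℝ))⁻¹)]
          have : (n : ℝ) * (√(n : ℝ))⁻¹ ^ 2 = 1 := by rw [hsn]; field_simp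
          linear_combination (√(n : ℝ))⁻¹ * (|t| * C) ^ 3 * this

/-! ### The deconvolution kernel -/

/-- The even Fourier weight `φ (h t) exp (σ² t² / 2)` of the estimator: the Fourier transform of
the rescaled kernel divided by the characteristic function of the error. -/
noncomputable def deconvWeight (σ : ℝ) (φ : ℝ → ℝ) (h t : ℝ) : ℝ :=
  φ (h * t) * Real.exp (σ ^ 2 * t ^ 2 / 2)

/-- The deconvolution kernel `u ↦ (2 π)⁻¹ ∫ cos (t u) φ (h t) exp (σ² t² / 2) dt`. The weight being
even, the cosine may stand for `exp (i t u)`, which makes the kernel real by definition. The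
estimator at `x₀` is the sample mean of its values at `X j - x₀`. -/
noncomputable def deconvKernel (σ : ℝ) (φ : ℝ → ℝ) (h u : ℝ) : ℝ :=
  (2 * Real.pi)⁻¹ * ∫ t, Real.cos (t * u) * deconvWeight σ φ h t

theorem measurable_deconvWeight {φ : ℝ → ℝ} (hφ : Measurable φ) (σ h : ℝ) :
    Measurable (deconvWeight σ φ h) := by
  unfold deconvWeight
  fun_prop

theorem measurable_deconvKernel {φ : ℝ → ℝ} (hφ : Measurable φ) (σ h : ℝ) :
    Measurable (deconvKernel σ φ h) := by
  have hmeas : Measurable fun q : ℝ × ℝ => Real.cos (q.2 * q.1) * deconvWeight σ φ h q.2 := by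
    have := measurable_deconvWeight hφ σ h
    fun_prop
  exact (hmeas.stronglyMeasurable.integral_prod_right).measurable.const_mul _

theorem deconvWeight_neg {φ : ℝ → ℝ} (hφ : ∀ t, φ (-t) = φ t) (σ h t : ℝ) :
    deconvWeight σ φ h (-t) = deconvWeight σ φ h t := by
  simp [deconvWeight, hφ]

theorem deconvWeight_eq_zero {φ : ℝ → ℝ} (hφ : Function.support φ ⊆ Set.Icc (-1) 1) {σ h t : ℝ}
    (ht : 1 < |h * t|) : deconvWeight σ φ h t = 0 := by
  have : φ (h * t) = 0 := by
    by_contra hne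
    exact ht.not_ge (abs_le.2 (hφ hne))
  simp [deconvWeight, this]

theorem KernelCondition.integrable_deconvWeight {φ : ℝ → ℝ} {A α : ℝ} (hφ : KernelCondition φ A α)
    (σ : ℝ) {h : ℝ} (hh : 0 < h) : Integrable (deconvWeight σ φ h) := by
  obtain ⟨C, hC⟩ := hφ.bounded
  have hsupp : Function.support (deconvWeight σ φ h) ⊆ Set.Icc (-h⁻¹) h⁻¹ := by
    intro t ht
    have h1 : |h * t| ≤ 1 := not_lt.1 fun hlt => ht (deconvWeight_eq_zero hφ.support_subset hlt)
    rw [abs_mul, abs_of_pos hh] at h1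
    exact abs_le.1 (by rwa [← one_div, le_div_iff₀' hh])
  rw [← integrableOn_iff_integrable_of_support_subset hsupp]
  have hexp : IntegrableOn (fun t : ℝ => Real.exp (σ ^ 2 * t ^ 2 / 2)) (Set.Icc (-h⁻¹) h⁻¹) :=
    (by fun_prop : Continuous fun t : ℝ => Real.exp (σ ^ 2 * t ^ 2 / 2)).integrableOn_Icc
  exact hexp.bdd_mul (c := C) (hφ.measurable.comp (measurable_const_mul h)).aestronglyMeasurable
    (.of_forall fun t => hC (h * t))

theorem integral_exp_mul_deconvWeight {φ : ℝ → ℝ} {A α : ℝ} (hφ : KernelCondition φ A α)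
    (σ : ℝ) {h : ℝ} (hh : 0 < h) (u : ℝ) :
    ∫ t : ℝ, Complex.exp ((t * u : ℝ) * Complex.I) * (deconvWeight σ φ h t : ℂ) =
      ((∫ t, Real.cos (t * u) * deconvWeight σ φ h t : ℝ) : ℂ) := by
  have hint := hφ.integrable_deconvWeight σ hh
  have hcos : Integrable fun t => Real.cos (t * u) * deconvWeight σ φ h t :=
    hint.bdd_mul (c := 1) (by fun_prop) (.of_forall fun t => Real.abs_cos_le_one _)
  have hsin : Integrable fun t => Real.sin (t * u) * deconvWeight σ φ h t :=
    hint.bdd_mul (c := 1) (by fun_prop) (.of_forall fun t => Real.abs_sin_le_one _)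
  have hodd : ∫ t, Real.sin (t * u) * deconvWeight σ φ h t = 0 := by
    have := integral_neg_eq_self (fun t => Real.sin (t * u) * deconvWeight σ φ h t) volume
    simp only [neg_mul, Real.sin_neg, deconvWeight_neg hφ.symmetric] at this
    rw [integral_neg] at this
    linarith
  calc _ = ∫ t, (((Real.cos (t * u) * deconvWeight σ φ h t : ℝ) : ℂ) +
        ((Real.sin (t * u) * deconvWeight σ φ h t : ℝ) : ℂ) * Complex.I) := by
        refine integral_congr_ae (.of_forall fun t => ?_)
        simp only [Complex.exp_mul_I]
        push_cast
        ring
    _ = _ := by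
        rw [integral_add hcos.ofReal (hsin.ofReal.mul_const _), integral_mul_const,
          integral_complex_ofReal, integral_complex_ofReal, hodd]
        simp

theorem deconvEstimator_eq_mean {φ : ℝ → ℝ} {A α : ℝ} (hφ : KernelCondition φ A α)
    (σ : ℝ) {h : ℝ} (hh : 0 < h) (n : ℕ) (x : ℕ → ℝ) (x₀ : ℝ) :
    deconvEstimator σ φ n h x x₀ =
      (((n : ℝ)⁻¹ * ∑ j ∈ Finset.range n, deconvKernel σ φ h (x j - x₀) : ℝ) : ℂ) := by
  have hint (j : ℕ) : Integrable fun t : ℝ =>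
      Complex.exp ((t * (x j - x₀) : ℝ) * Complex.I) * (deconvWeight σ φ h t : ℂ) := by
    refine (hφ.integrable_deconvWeight σ hh).ofReal.bdd_mul (c := 1) (by fun_prop)
      (.of_forall fun t => ?_)
    rw [Complex.norm_exp_ofReal_mul_I]
  have hpt (t : ℝ) : Complex.exp (-(Complex.I * t * x₀)) *
      (empiricalCharFun n x t * (φ (h * t) : ℂ) / (Real.exp (-(σ ^ 2 * t ^ 2 / 2)) : ℂ)) =
      (n : ℂ)⁻¹ * ∑ j ∈ Finset.range n,
        Complex.exp ((t * (x j - x₀) : ℝ) * Complex.I) * (deconvWeight σ φ h t : ℂ) := by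
    simp only [empiricalCharFun, deconvWeight, one_div]
    rw [Real.exp_neg, ← Finset.sum_mul]
    have hsum : ∑ j ∈ Finset.range n, Complex.exp ((t * (x j - x₀) : ℝ) * Complex.I) =
        Complex.exp (-(Complex.I * t * x₀)) *
          ∑ j ∈ Finset.range n, Complex.exp (Complex.I * t * x j) := by
      rw [Finset.mul_sum]
      refine Finset.sum_congr rfl fun j _ => ?_
      rw [← Complex.exp_add]
      congr 1
      push_cast
      ring
    rw [hsum]
    push_cast
    rw [div_inv_eq_mul]
    ring
  simp only [deconvEstimator, hpt]
  rw [integral_const_mul, integral_finsetSum _ fun j _ => hint j]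
  simp only [integral_exp_mul_deconvWeight hφ σ hh, deconvKernel, ← Finset.mul_sum]
  push_cast
  ring

/-! ### The behaviour of the kernel as the bandwidth vanishes -/

/-- The power bound that the expansion at the edge `1` gives for small `v` extends to all `v > 0`,
because `φ` is bounded and `α ≥ 0`. -/
theorem KernelCondition.exists_abs_le_rpow {φ : ℝ → ℝ} {A α : ℝ} (hφ : KernelCondition φ A α) :
    ∃ C, 0 ≤ C ∧ ∀ v, 0 < v → |φ (1 - v)| ≤ C * v ^ α := by
  obtain ⟨M, hM⟩ := hφ.bounded
  have hM0 : 0 ≤ M := (abs_nonneg _).trans (hM 0)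
  have hnear : ∀ᶠ v in 𝓝[>] (0 : ℝ), |φ (1 - v)| ≤ (1 + |A|) * v ^ α := by
    filter_upwards [hφ.expansion.bound one_pos, self_mem_nhdsWithin] with v hv hv0
    have hvα : 0 ≤ v ^ α := Real.rpow_nonneg (le_of_lt hv0) α
    rw [one_mul, Real.norm_eq_abs, Real.norm_eq_abs, abs_of_nonneg hvα] at hv
    calc |φ (1 - v)| = |(φ (1 - v) - A * v ^ α) + A * v ^ α| := by ring_nf
      _ ≤ |φ (1 - v) - A * v ^ α| + |A * v ^ α| := abs_add_le _ _
      _ ≤ v ^ α + |A| * v ^ α := by rw [abs_mul, abs_of_nonneg hvα]; gcongr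
      _ = _ := by ring
  obtain ⟨δ, hδ, hδv⟩ := mem_nhdsGT_iff_exists_Ioo_subset.1 hnear
  have hδ : 0 < δ := hδ
  have hδα : 0 < δ ^ α := Real.rpow_pos_of_pos hδ α
  refine ⟨max (1 + |A|) (M / δ ^ α), le_max_of_le_left (by positivity), fun v hv => ?_⟩
  rcases lt_or_ge v δ with hlt | hge
  · exact (hδv ⟨hv, hlt⟩).trans
      (mul_le_mul_of_nonneg_right (le_max_left _ _) (Real.rpow_nonneg hv.le α))
  · calc |φ (1 - v)| ≤ M := hM _
      _ = M / δ ^ α * δ ^ α := by field_simp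
      _ ≤ M / δ ^ α * v ^ α := by
          gcongr
          exact hφ.alpha_nonneg
      _ ≤ _ := mul_le_mul_of_nonneg_right (le_max_right _ _) (Real.rpow_nonneg hv.le α)

theorem KernelCondition.tendsto_div_rpow {φ : ℝ → ℝ} {A α : ℝ} (hφ : KernelCondition φ A α) :
    Tendsto (fun v => φ (1 - v) / v ^ α) (𝓝[>] 0) (𝓝 A) := by
  have h := hφ.expansion.tendsto_div_nhds_zero.add_const A
  rw [zero_add] at h
  refine h.congr' ?_
  filter_upwards [self_mem_nhdsWithin] with v hv
  have : v ^ α ≠ 0 := (Real.rpow_pos_of_pos hv α).ne'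
  field_simp
  ring

/-- The weight `φ (h t) exp (σ² t² / 2)` near the edge `t = 1 / h` of its support, in the coordinate
`t = 1 / h - h y` and divided by `h ^ (2 α) exp (σ² / (2 h²))`. It is cut off at `h ^ 2 y = 1`, that
is at `t = 0`, so that only one of the two symmetric edges is covered. -/
noncomputable def edgeProfile (σ : ℝ) (φ : ℝ → ℝ) (α h y : ℝ) : ℝ :=
  if h ^ 2 * y < 1 then
    φ (1 - h ^ 2 * y) / (h ^ 2) ^ α * Real.exp (-(σ ^ 2 * y) + σ ^ 2 * (h ^ 2 * y) * y / 2)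
  else 0

theorem measurable_edgeProfile {φ : ℝ → ℝ} (hφ : Measurable φ) (σ α h : ℝ) :
    Measurable (edgeProfile σ φ α h) := by
  refine Measurable.ite (measurableSet_lt (by fun_prop) measurable_const) ?_ measurable_const
  fun_prop

/-- An integrable bound uniform in `h`: on the support of the profile `h ^ 2 * y < 1`, so the
quadratic term in the exponent takes away at most half of the linear decay. -/
theorem abs_edgeProfile_le {φ : ℝ → ℝ} {C α : ℝ} (hC : 0 ≤ C)
    (hφ : ∀ v, 0 < v → |φ (1 - v)| ≤ C * v ^ α) (σ : ℝ) {h y : ℝ} (hh : 0 < h) (hy : 0 < y) :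
    |edgeProfile σ φ α h y| ≤ C * (y ^ α * Real.exp (-(σ ^ 2 / 2 * y))) := by
  have hy0 : 0 ≤ y ^ α := Real.rpow_nonneg hy.le α
  unfold edgeProfile
  split_ifs with hlt
  · rw [abs_mul, Real.abs_exp, abs_div, abs_of_pos (Real.rpow_pos_of_pos (pow_pos hh 2) α),
      ← mul_assoc C]
    refine mul_le_mul ?_ (Real.exp_le_exp.2 ?_) (Real.exp_nonneg _) (by positivity)
    · rw [div_le_iff₀ (Real.rpow_pos_of_pos (pow_pos hh 2) α)]
      calc |φ (1 - h ^ 2 * y)| ≤ C * (h ^ 2 * y) ^ α := hφ _ (by positivity)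
        _ = _ := by rw [Real.mul_rpow (by positivity) hy.le]; ring
    · have : σ ^ 2 * y * (h ^ 2 * y) ≤ σ ^ 2 * y * 1 :=
        mul_le_mul_of_nonneg_left hlt.le (by positivity)
      linarith
  · rw [abs_zero]
    positivity

theorem KernelCondition.tendsto_edgeProfile {φ : ℝ → ℝ} {A α : ℝ} (hφ : KernelCondition φ A α)
    (σ : ℝ) {h : ℕ → ℝ} (hpos : ∀ n, 0 < h n) (hlim : Tendsto h atTop (𝓝 0)) {y : ℝ} (hy : 0 < y) :
    Tendsto (fun n => edgeProfile σ φ α (h n) y) atTop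
      (𝓝 (A * (y ^ α * Real.exp (-(σ ^ 2 * y))))) := by
  have hv : Tendsto (fun n => h n ^ 2 * y) atTop (𝓝 0) := by
    simpa using (hlim.pow 2).mul_const y
  have hv' : Tendsto (fun n => h n ^ 2 * y) atTop (𝓝[>] 0) :=
    tendsto_nhdsWithin_iff.2 ⟨hv, .of_forall fun n => mul_pos (pow_pos (hpos n) 2) hy⟩
  have hexp : Tendsto (fun n => Real.exp (-(σ ^ 2 * y) + σ ^ 2 * (h n ^ 2 * y) * y / 2)) atTop
      (𝓝 (Real.exp (-(σ ^ 2 * y)))) := by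
    refine (Real.continuous_exp.tendsto _).comp ?_
    simpa using (((hv.const_mul (σ ^ 2)).mul_const y).div_const 2).const_add (-(σ ^ 2 * y))
  have hmain := ((hφ.tendsto_div_rpow.comp hv').mul_const (y ^ α)).mul hexp
  rw [mul_assoc] at hmain
  refine hmain.congr' ?_
  filter_upwards [hv.eventually_lt_const one_pos] with n hn
  have hyα : y ^ α ≠ 0 := (Real.rpow_pos_of_pos hy α).ne'
  have hhα : (h n ^ 2) ^ α ≠ 0 := (Real.rpow_pos_of_pos (pow_pos (hpos n) 2) α).ne'
  simp only [edgeProfile, if_pos hn, Function.comp_apply]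
  rw [Real.mul_rpow (sq_nonneg _) hy.le]
  field_simp

/-- Exact form of the normalised kernel after the substitution `t = 1 / h - h y` in the integral
over `t > 0`; the normalisation `h ^ (1 + 2 α) exp (σ² / (2 h²))` is what the substitution produces. -/
theorem KernelCondition.deconvKernel_div_eq {φ : ℝ → ℝ} {A α : ℝ} (hφ : KernelCondition φ A α)
    (σ : ℝ) {h : ℝ} (hh : 0 < h) (u : ℝ) :
    deconvKernel σ φ h u / (h ^ (1 + 2 * α) * Real.exp (σ ^ 2 / (2 * h ^ 2))) =
      Real.pi⁻¹ * ∫ y in Set.Ioi 0, Real.cos (h⁻¹ * u - h * y * u) * edgeProfile σ φ α h y := by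
  set G : ℝ → ℝ := (Set.Ioi 0).indicator fun t => Real.cos (t * u) * deconvWeight σ φ h t with hG
  have hsub : ∫ t, G t = h * ∫ y, G (h⁻¹ - h * y) := by
    rw [Measure.integral_comp_mul_left (fun z => G (h⁻¹ - z)) h,
      integral_sub_left_eq_self G volume h⁻¹, abs_of_pos (inv_pos.2 hh), smul_eq_mul,
      mul_inv_cancel_left₀ hh.ne']
  have hhalf : ∫ t, Real.cos (t * u) * deconvWeight σ φ h t = 2 * ∫ t, G t := by
    rw [hG, integral_indicator measurableSet_Ioi, ← integral_comp_abs]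
    refine integral_congr_ae (.of_forall fun t => ?_)
    rcases abs_choice t with ht | ht <;>
      simp only [ht, neg_mul, Real.cos_neg, deconvWeight_neg hφ.symmetric]
  set c : ℝ := h ^ (1 + 2 * α) * Real.exp (σ ^ 2 / (2 * h ^ 2)) with hc
  have hcpos : 0 < c := mul_pos (Real.rpow_pos_of_pos hh _) (Real.exp_pos _)
  have hpow : h ^ (1 + 2 * α) = h * (h ^ 2) ^ α := by
    rw [Real.rpow_add hh, Real.rpow_one, ← Real.rpow_natCast, ← Real.rpow_mul hh.le]
    norm_num
  -- Negative `y` correspond to `t > 1 / h`, outside the support of the weight.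
  have hrestrict : ∫ y, G (h⁻¹ - h * y) = ∫ y in Set.Ioi 0, G (h⁻¹ - h * y) := by
    refine (setIntegral_eq_integral_of_ae_compl_eq_zero ?_).symm
    filter_upwards [Measure.ae_ne volume (0 : ℝ)] with y hy0 hy
    have hy' : y < 0 := lt_of_le_of_ne (not_lt.1 hy) hy0
    have h1 : 1 < |h * (h⁻¹ - h * y)| := by
      have : h * (h⁻¹ - h * y) = 1 - h ^ 2 * y := by field_simp
      rw [this]
      have : h ^ 2 * y < 0 := mul_neg_of_pos_of_neg (by positivity) hy'
      exact (by linarith : 1 < 1 - h ^ 2 * y).trans_le (le_abs_self _)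
    rw [hG, Set.indicator_apply]
    split_ifs
    · rw [deconvWeight_eq_zero hφ.support_subset h1, mul_zero]
    · rfl
  have hpt (y : ℝ) : h * G (h⁻¹ - h * y) =
      c * (Real.cos (h⁻¹ * u - h * y * u) * edgeProfile σ φ α h y) := by
    have hiff : h⁻¹ - h * y ∈ Set.Ioi (0 : ℝ) ↔ h ^ 2 * y < 1 := by
      rw [Set.mem_Ioi, sub_pos, ← one_div, lt_div_iff₀' hh, ← mul_assoc, ← sq]
    rw [hG, Set.indicator_apply, edgeProfile]
    simp only [hiff]
    split_ifs
    · have h1 : h * (h⁻¹ - h * y) = 1 - h ^ 2 * y := by field_simp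
      have h2 : σ ^ 2 * (h⁻¹ - h * y) ^ 2 / 2 =
          σ ^ 2 / (2 * h ^ 2) + (-(σ ^ 2 * y) + σ ^ 2 * (h ^ 2 * y) * y / 2) := by
        field_simp
        ring
      have hhα : (h ^ 2) ^ α ≠ 0 := (Real.rpow_pos_of_pos (pow_pos hh 2) α).ne'
      rw [deconvWeight, h1, h2, Real.exp_add, hc, hpow, sub_mul]
      field_simp
    · simp
  rw [deconvKernel, hhalf, hsub, hrestrict, ← integral_const_mul]
  simp only [hpt]
  rw [integral_const_mul]
  field_simp

/-- The normalised kernel is uniformly bounded, and asymptotically a pure cosine of frequency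
`1 / h`. The amplitude `κ` is `π⁻¹` times the limit `A Γ(α + 1) σ ^ (-2 (α + 1))` of the integral of the edge
profile; the phase shift `h y u` disappears in the limit. -/
theorem KernelCondition.deconvKernel_div_asymptotics {φ : ℝ → ℝ} {A α : ℝ}
    (hφ : KernelCondition φ A α) {σ : ℝ} (hσ : 0 < σ) {h : ℕ → ℝ} (hpos : ∀ n, 0 < h n)
    (hlim : Tendsto h atTop (𝓝 0)) {κ : ℝ}
    (hκ : κ = Real.pi⁻¹ * (A * ((1 / σ ^ 2) ^ (α + 1) * Real.Gamma (α + 1)))) :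
    (∃ C, ∀ n u, |deconvKernel σ φ (h n) u /
      (h n ^ (1 + 2 * α) * Real.exp (σ ^ 2 / (2 * h n ^ 2)))| ≤ C) ∧
    ∀ u, Tendsto (fun n => deconvKernel σ φ (h n) u /
      (h n ^ (1 + 2 * α) * Real.exp (σ ^ 2 / (2 * h n ^ 2))) - κ * Real.cos ((h n)⁻¹ * u))
      atTop (𝓝 0) := by
  obtain ⟨C, hC0, hC⟩ := hφ.exists_abs_le_rpow
  have hα : 0 < α + 1 := by linarith [hφ.alpha_nonneg]
  have hdom {b : ℝ} (hb : 0 < b) :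
      IntegrableOn (fun y : ℝ => y ^ α * Real.exp (-(b * y))) (Set.Ioi 0) := by
    have := integrableOn_rpow_mul_exp_neg_mul_rpow (s := α) (p := 1) (b := b) (by linarith)
      one_pos hb
    simpa using this
  have hσ2 : 0 < σ ^ 2 / 2 := by positivity
  have hFmeas (n : ℕ) (u : ℝ) : Measurable fun y =>
      Real.cos ((h n)⁻¹ * u - h n * y * u) * edgeProfile σ φ α (h n) y := by
    have := measurable_edgeProfile hφ.measurable σ α (h n)
    fun_prop
  have hFle (n : ℕ) (u : ℝ) {y : ℝ} (hy : 0 < y) :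
      |Real.cos ((h n)⁻¹ * u - h n * y * u) * edgeProfile σ φ α (h n) y| ≤
        C * (y ^ α * Real.exp (-(σ ^ 2 / 2 * y))) := by
    rw [abs_mul]
    exact (mul_le_of_le_one_left (abs_nonneg _) (Real.abs_cos_le_one _)).trans
      (abs_edgeProfile_le hC0 hC σ (hpos n) hy)
  have hFint (n : ℕ) (u : ℝ) : IntegrableOn (fun y =>
      Real.cos ((h n)⁻¹ * u - h n * y * u) * edgeProfile σ φ α (h n) y) (Set.Ioi 0) := by
    refine ((hdom hσ2).const_mul C).mono' (hFmeas n u).aestronglyMeasurable ?_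
    filter_upwards [ae_restrict_mem measurableSet_Ioi] with y hy using hFle n u hy
  simp only [hφ.deconvKernel_div_eq σ (hpos _)]
  refine ⟨⟨Real.pi⁻¹ * ∫ y in Set.Ioi 0, C * (y ^ α * Real.exp (-(σ ^ 2 / 2 * y))),
    fun n u => ?_⟩, fun u => ?_⟩
  · rw [abs_mul, abs_of_pos (inv_pos.2 Real.pi_pos)]
    refine mul_le_mul_of_nonneg_left ?_ (inv_nonneg.2 Real.pi_pos.le)
    rw [← Real.norm_eq_abs]
    refine norm_integral_le_of_norm_le ((hdom hσ2).const_mul C) ?_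
    filter_upwards [ae_restrict_mem measurableSet_Ioi] with y hy using hFle n u hy
  · set B : ℝ → ℝ := fun y => A * (y ^ α * Real.exp (-(σ ^ 2 * y))) with hB
    have hBint : IntegrableOn B (Set.Ioi 0) := (hdom (by positivity)).const_mul A
    have hBval : ∫ y in Set.Ioi 0, B y = A * ((1 / σ ^ 2) ^ (α + 1) * Real.Gamma (α + 1)) := by
      rw [hB, integral_const_mul, ← Real.integral_rpow_mul_exp_neg_mul_Ioi hα (by positivity)]
      simp
    have heq (n : ℕ) : Real.pi⁻¹ * (∫ y in Set.Ioi 0,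
        Real.cos ((h n)⁻¹ * u - h n * y * u) * edgeProfile σ φ α (h n) y) -
          κ * Real.cos ((h n)⁻¹ * u) =
        Real.pi⁻¹ * ∫ y in Set.Ioi 0,
          (Real.cos ((h n)⁻¹ * u - h n * y * u) * edgeProfile σ φ α (h n) y -
            Real.cos ((h n)⁻¹ * u) * B y) := by
      rw [integral_sub (hFint n u) (hBint.const_mul _), integral_const_mul, hBval, hκ]
      ring
    simp only [heq]
    have hzero : 𝓝 (0 : ℝ) = 𝓝 (Real.pi⁻¹ * ∫ _ in Set.Ioi (0 : ℝ), (0 : ℝ)) := by simp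
    rw [hzero]
    refine Tendsto.const_mul _ ?_
    refine tendsto_integral_of_dominated_convergence
      (fun y => C * (y ^ α * Real.exp (-(σ ^ 2 / 2 * y))) + |B y|)
      (fun n => ((hFint n u).sub
        (hBint.const_mul (Real.cos ((h n)⁻¹ * u)))).aestronglyMeasurable)
      (((hdom hσ2).const_mul C).add hBint.abs) (fun n => ?_) ?_
    · filter_upwards [ae_restrict_mem measurableSet_Ioi] with y hy
      refine (norm_sub_le _ _).trans (add_le_add (hFle n u hy) ?_)
      rw [Real.norm_eq_abs, abs_mul]
      exact mul_le_of_le_one_left (abs_nonneg _) (Real.abs_cos_le_one _)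
    · filter_upwards [ae_restrict_mem measurableSet_Ioi] with y hy
      have h1 := (hφ.tendsto_edgeProfile σ hpos hlim hy).sub_const (B y)
      have h2 : Tendsto (fun n => |h n * y * u|) atTop (𝓝 0) := by
        simpa using ((hlim.mul_const y).mul_const u).abs
      have h3 : Tendsto (fun n => |edgeProfile σ φ α (h n) y - B y| +
          |h n * y * u| * |B y|) atTop (𝓝 0) := by
        have := h1.abs.add (h2.mul_const |B y|)
        simpa [hB] using this
      refine squeeze_zero_norm (fun n => ?_) h3
      have hcos : |Real.cos ((h n)⁻¹ * u - h n * y * u) - Real.cos ((h n)⁻¹ * u)| ≤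
          |h n * y * u| := by
        refine (Real.abs_cos_sub_cos_le _ _).trans (le_of_eq ?_)
        rw [sub_sub_cancel_left, abs_neg]
      calc _ = |Real.cos ((h n)⁻¹ * u - h n * y * u) * (edgeProfile σ φ α (h n) y - B y) +
            (Real.cos ((h n)⁻¹ * u - h n * y * u) - Real.cos ((h n)⁻¹ * u)) * B y| := by
            rw [Real.norm_eq_abs]; ring_nf
        _ ≤ _ := by
            refine (abs_add_le _ _).trans ?_
            rw [abs_mul, abs_mul]
            exact add_le_add
              (mul_le_of_le_one_left (abs_nonneg _) (Real.abs_cos_le_one _))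
              (mul_le_mul_of_nonneg_right hcos (abs_nonneg _))

/-! ### Asymptotic normality of the estimator -/

/-- First two moments of a bounded sequence of functions that is asymptotically
`κ cos (s n (x - x₀))` with `s n → ∞`: by the Riemann–Lebesgue lemma they are asymptotically those
of `κ cos θ` with `θ` uniform on a period. -/
theorem tendsto_integral_of_asymptotically_cos {μ : Measure ℝ} [IsProbabilityMeasure μ]
    (hμ : μ ≪ volume) {x₀ κ C : ℝ} {s : ℕ → ℝ} (hs : Tendsto s atTop atTop) {w : ℕ → ℝ → ℝ}
    (hw : ∀ n, Measurable (w n)) (hC : ∀ n x, |w n x| ≤ C)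
    (hcos : ∀ x, Tendsto (fun n => w n x - κ * Real.cos (s n * (x - x₀))) atTop (𝓝 0)) :
    Tendsto (fun n => ∫ x, w n x ∂μ) atTop (𝓝 0) ∧
      Tendsto (fun n => ∫ x, w n x ^ 2 ∂μ) atTop (𝓝 (κ ^ 2 / 2)) := by
  have hC0 : 0 ≤ C := (abs_nonneg _).trans (hC 0 0)
  have hint (n : ℕ) : Integrable (w n) μ :=
    .of_bound (hw n).aestronglyMeasurable C (.of_forall (hC n))
  have hw2 (n : ℕ) (x : ℝ) : ‖w n x ^ 2‖ ≤ C ^ 2 := by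
    rw [norm_pow]; exact pow_le_pow_left₀ (norm_nonneg _) (hC n x) 2
  have hint2 (n : ℕ) : Integrable (fun x => w n x ^ 2) μ :=
    .of_bound ((hw n).pow_const 2).aestronglyMeasurable (C ^ 2) (.of_forall (hw2 n))
  have hcle (n : ℕ) (x : ℝ) : ‖κ * Real.cos (s n * (x - x₀))‖ ≤ |κ| := by
    rw [norm_mul]
    exact mul_le_of_le_one_right (abs_nonneg κ) (Real.abs_cos_le_one _)
  have hcle2 (n : ℕ) (x : ℝ) : ‖(κ * Real.cos (s n * (x - x₀))) ^ 2‖ ≤ |κ| ^ 2 := by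
    rw [norm_pow]; exact pow_le_pow_left₀ (norm_nonneg _) (hcle n x) 2
  have hcint (n : ℕ) : Integrable (fun x => κ * Real.cos (s n * (x - x₀))) μ :=
    .of_bound (by fun_prop) |κ| (.of_forall (hcle n))
  have hcint2 (n : ℕ) : Integrable (fun x => (κ * Real.cos (s n * (x - x₀))) ^ 2) μ :=
    .of_bound (by fun_prop) (|κ| ^ 2) (.of_forall (hcle2 n))
  have hRL := tendsto_integral_cos_of_absolutelyContinuous hμ x₀ hs
  have hRL2 := tendsto_integral_cos_of_absolutelyContinuous hμ x₀
    (hs.const_mul_atTop (two_pos : (0 : ℝ) < 2))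
  constructor
  · have h1 : Tendsto (fun n => ∫ x, (w n x - κ * Real.cos (s n * (x - x₀))) ∂μ) atTop
        (𝓝 (∫ _, (0 : ℝ) ∂μ)) :=
      tendsto_integral_of_dominated_convergence (fun _ => C + |κ|)
        (fun n => ((hint n).sub (hcint n)).aestronglyMeasurable) (integrable_const _)
        (fun n => .of_forall fun x => (norm_sub_le _ _).trans (add_le_add (hC n x) (hcle n x)))
        (.of_forall hcos)
    have h2 := h1.add (hRL.const_mul κ)
    simp only [integral_zero, mul_zero, add_zero] at h2
    refine h2.congr fun n => ?_
    rw [integral_sub (hint n) (hcint n), integral_const_mul, sub_add_cancel]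
  · have hpt (x : ℝ) : Tendsto (fun n => w n x ^ 2 - (κ * Real.cos (s n * (x - x₀))) ^ 2) atTop
        (𝓝 0) := by
      have h3 := (hcos x).abs.const_mul (C + |κ|)
      rw [abs_zero, mul_zero] at h3
      refine squeeze_zero_norm (fun n => ?_) h3
      rw [sq_sub_sq, norm_mul]
      exact mul_le_mul_of_nonneg_right
        ((norm_add_le _ _).trans (add_le_add (hC n x) (hcle n x))) (abs_nonneg _)
    have h1 : Tendsto (fun n => ∫ x, (w n x ^ 2 - (κ * Real.cos (s n * (x - x₀))) ^ 2) ∂μ) atTop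
        (𝓝 (∫ _, (0 : ℝ) ∂μ)) :=
      tendsto_integral_of_dominated_convergence (fun _ => C ^ 2 + |κ| ^ 2)
        (fun n => ((hint2 n).sub (hcint2 n)).aestronglyMeasurable) (integrable_const _)
        (fun n => .of_forall fun x => (norm_sub_le _ _).trans (add_le_add (hw2 n x) (hcle2 n x)))
        (.of_forall hpt)
    have hsq (n : ℕ) : ∫ x, (κ * Real.cos (s n * (x - x₀))) ^ 2 ∂μ =
        κ ^ 2 / 2 + κ ^ 2 / 2 * ∫ x, Real.cos (2 * s n * (x - x₀)) ∂μ := by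
      have hb : Integrable (fun x => κ ^ 2 / 2 * Real.cos (2 * s n * (x - x₀))) μ :=
        (Integrable.of_bound (by fun_prop) 1
          (.of_forall fun x => Real.abs_cos_le_one _)).const_mul _
      calc _ = ∫ x, (κ ^ 2 / 2 + κ ^ 2 / 2 * Real.cos (2 * s n * (x - x₀))) ∂μ := by
            refine integral_congr_ae (.of_forall fun x => ?_)
            simp only
            rw [mul_pow, Real.cos_sq, mul_assoc]
            ring
        _ = _ := by
            rw [integral_add (integrable_const _) hb, integral_const_mul]
            simp
    have h2 := h1.add ((hRL2.const_mul (κ ^ 2 / 2)).const_add (κ ^ 2 / 2))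
    simp only [integral_zero, mul_zero, add_zero, zero_add] at h2
    refine h2.congr fun n => ?_
    rw [integral_sub (hint2 n) (hcint2 n), hsq, sub_add_cancel]

theorem tendstoInDistribution_inv_sqrt_mul_sum_sub_mean {Ω : Type*} [MeasurableSpace Ω]
    {P : Measure Ω} [IsProbabilityMeasure P] {X : ℕ → Ω → ℝ} (hindep : iIndepFun X P)
    (hident : ∀ i, IdentDistrib (X i) (X 0) P P) {w : ℕ → ℝ → ℝ} (hw : ∀ n, Measurable (w n))
    {C : ℝ} (hC : ∀ n x, |w n x| ≤ C) {v : NNReal}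
    (hmean : Tendsto (fun n => ∫ ω, w n (X 0 ω) ∂P) atTop (𝓝 0))
    (hsq : Tendsto (fun n => ∫ ω, w n (X 0 ω) ^ 2 ∂P) atTop (𝓝 v)) :
    TendstoInDistribution (fun (n : ℕ) ω =>
        (√(n : ℝ))⁻¹ * ∑ j ∈ Finset.range n, (w n (X j ω) - ∫ ω', w n (X 0 ω') ∂P))
      atTop (id : ℝ → ℝ) (fun _ => P) (gaussianReal 0 v) := by
  have hX0 := (hident 0).aemeasurable_fst
  have hmeas (n : ℕ) : AEMeasurable (fun ω => w n (X 0 ω)) P := (hw n).comp_aemeasurable hX0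
  have hint (n : ℕ) : Integrable (fun ω => w n (X 0 ω)) P :=
    .of_bound (hmeas n).aestronglyMeasurable C (.of_forall fun ω => hC n _)
  have hint2 (n : ℕ) : Integrable (fun ω => w n (X 0 ω) ^ 2) P := by
    refine .of_bound ((hmeas n).pow_const 2).aestronglyMeasurable (C ^ 2) (.of_forall fun ω => ?_)
    rw [norm_pow]; exact pow_le_pow_left₀ (norm_nonneg _) (hC n _) 2
  have hm (n : ℕ) : ‖∫ ω, w n (X 0 ω) ∂P‖ ≤ C := by
    simpa using norm_integral_le_of_norm_le_const (μ := P) (f := fun ω => w n (X 0 ω))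
      (.of_forall fun ω => hC n (X 0 ω))
  refine tendstoInDistribution_inv_sqrt_mul_sum_of_bounded_array hindep hident
    (d := fun n x => w n x - ∫ ω', w n (X 0 ω') ∂P) (fun n => (hw n).sub_const _) (C := C + C)
    (fun n x => (norm_sub_le _ _).trans (add_le_add (hC n x) (hm n))) (fun n => ?_) ?_
  · rw [integral_sub (hint n) (integrable_const _)]
    simp
  · have h1 := hsq.sub (hmean.pow 2)
    simp only [ne_eq, OfNat.ofNat_ne_zero, not_false_eq_true, zero_pow, sub_zero] at h1
    refine h1.congr fun n => ?_
    have hpt (ω : Ω) : (w n (X 0 ω) - ∫ ω', w n (X 0 ω') ∂P) ^ 2 =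
        w n (X 0 ω) ^ 2 - 2 * (∫ ω', w n (X 0 ω') ∂P) * w n (X 0 ω) +
          (∫ ω', w n (X 0 ω') ∂P) ^ 2 := by ring
    have hlin := (hint n).const_mul (2 * ∫ ω', w n (X 0 ω') ∂P)
    simp only [hpt]
    rw [integral_add (by exact (hint2 n).sub hlin) (integrable_const _),
      integral_sub (hint2 n) hlin, integral_const_mul]
    simp
    ring

theorem corollary5p1 {Ω : Type*} [MeasurableSpace Ω] (P : Measure Ω) [IsProbabilityMeasure P]
    -- error standard deviation, kernel and bandwidths
    (σ : ℝ) (hσ : 0 < σ)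
    (φ : ℝ → ℝ) (A α : ℝ) (hφ : KernelCondition φ A α)
    (h : ℕ → ℝ) (hpos : ∀ n, 0 < h n) (hlim : Tendsto h atTop (𝓝 0))
    -- i.i.d. observations with finite second moment
    (X : ℕ → Ω → ℝ) (hindep : iIndepFun X P) (hident : ∀ i, IdentDistrib (X i) (X 0) P P)
    (hmoment : MemLp (X 0) 2 P)
    -- from an arbitrary absolutely continuous law, or from the atomic deconvolution model
    (hlaw : P.map (X 0) ≪ volume ∨
      ∃ (p : ℝ) (f : ℝ → ℝ), ∀ i, IsAtomicObservation P σ p f (X i))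
    (x₀ : ℝ) :
    -- the estimator is real valued
    (∀ n ω, (deconvEstimator σ φ n (h n) (fun j => X j ω) x₀).im = 0) ∧
    -- it has an expectation
    (∀ n, Integrable (fun ω => deconvEstimator σ φ n (h n) (fun j => X j ω) x₀) P) ∧
    -- the centred and normalised estimator is asymptotically normal
    TendstoInDistribution
      (fun (n : ℕ) (ω : Ω) =>
        √(n : ℝ) / (h n ^ (1 + 2 * α) * Real.exp (σ ^ 2 / (2 * h n ^ 2))) *
          (deconvEstimator σ φ n (h n) (fun j => X j ω) x₀ -
            ∫ ω', deconvEstimator σ φ n (h n) (fun j => X j ω') x₀ ∂P).re)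
      atTop (id : ℝ → ℝ) (fun _ => P)
      (gaussianReal 0 (Real.toNNReal
        (A ^ 2 * Real.Gamma (α + 1) ^ 2 / (2 * Real.pi ^ 2) * (1 / σ ^ 2) ^ (2 + 2 * α)))) := by
  have hX (j : ℕ) : AEMeasurable (X j) P := (hident j).aemeasurable_fst
  have := Measure.isProbabilityMeasure_map (hX 0)
  have hac : P.map (X 0) ≪ volume := by
    rcases hlaw with hlaw | ⟨p, f, hobs⟩
    · exact hlaw
    · exact (hobs 0).map_absolutelyContinuous hσ.ne'
  set κ : ℝ := Real.pi⁻¹ * (A * ((1 / σ ^ 2) ^ (α + 1) * Real.Gamma (α + 1))) with hκ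
  obtain ⟨⟨C, hC⟩, hasymp⟩ := hφ.deconvKernel_div_asymptotics hσ hpos hlim hκ
  set c : ℕ → ℝ := fun n => h n ^ (1 + 2 * α) * Real.exp (σ ^ 2 / (2 * h n ^ 2)) with hc
  have hcpos (n : ℕ) : 0 < c n := mul_pos (Real.rpow_pos_of_pos (hpos n) _) (Real.exp_pos _)
  set w : ℕ → ℝ → ℝ := fun n x => deconvKernel σ φ (h n) (x - x₀) / c n with hw
  have hwC (n : ℕ) (x : ℝ) : |w n x| ≤ C := hC n _
  have hwmeas (n : ℕ) : Measurable (w n) :=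
    ((measurable_deconvKernel hφ.measurable σ (h n)).comp (measurable_id.sub_const x₀)).div_const _
  have hs : Tendsto (fun n => (h n)⁻¹) atTop atTop :=
    tendsto_inv_nhdsGT_zero.comp (tendsto_nhdsWithin_iff.2 ⟨hlim, .of_forall hpos⟩)
  obtain ⟨hmean, hsq⟩ := tendsto_integral_of_asymptotically_cos hac hs hwmeas hwC
    fun x => hasymp (x - x₀)
  have hmap (n : ℕ) : ∫ x, w n x ∂(P.map (X 0)) = ∫ ω, w n (X 0 ω) ∂P :=
    integral_map (hX 0) (hwmeas n).aestronglyMeasurable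
  have hmap2 (n : ℕ) : ∫ x, w n x ^ 2 ∂(P.map (X 0)) = ∫ ω, w n (X 0 ω) ^ 2 ∂P :=
    integral_map (hX 0) ((hwmeas n).pow_const 2).aestronglyMeasurable
  simp only [hmap] at hmean
  simp only [hmap2] at hsq
  have hest (n : ℕ) (ω : Ω) : deconvEstimator σ φ n (h n) (fun j => X j ω) x₀ =
      ((c n * ((n : ℝ)⁻¹ * ∑ j ∈ Finset.range n, w n (X j ω)) : ℝ) : ℂ) := by
    rw [deconvEstimator_eq_mean hφ σ (hpos n)]
    have := (hcpos n).ne'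
    simp only [hw, ← Finset.sum_div]
    congr 1
    field_simp
  have hwint (n j : ℕ) : Integrable (fun ω => w n (X j ω)) P :=
    .of_bound ((hwmeas n).comp_aemeasurable (hX j)).aestronglyMeasurable C
      (.of_forall fun ω => hwC n _)
  have hmeanint (n : ℕ) : Integrable
      (fun ω => c n * ((n : ℝ)⁻¹ * ∑ j ∈ Finset.range n, w n (X j ω))) P :=
    ((integrable_finsetSum _ fun j _ => hwint n j).const_mul _).const_mul _
  refine ⟨fun n ω => by rw [hest, Complex.ofReal_im], fun n => ?_, ?_⟩
  · simp only [hest]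
    exact (hmeanint n).ofReal
  have hκsq : A ^ 2 * Real.Gamma (α + 1) ^ 2 / (2 * Real.pi ^ 2) * (1 / σ ^ 2) ^ (2 + 2 * α) =
      κ ^ 2 / 2 := by
    have h2 : (1 / σ ^ 2) ^ (2 + 2 * α) = ((1 / σ ^ 2) ^ (α + 1)) ^ 2 := by
      rw [← Real.rpow_mul_natCast (by positivity)]
      congr 1
      push_cast
      ring
    rw [h2, hκ]
    field_simp
  rw [hκsq]
  rw [← Real.coe_toNNReal (κ ^ 2 / 2) (by positivity)] at hsq
  refine (tendstoInDistribution_inv_sqrt_mul_sum_sub_mean hindep hident hwmeas hwC hmean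
    hsq).congr (fun n => .of_forall fun ω => ?_) .rfl
  simp only [hest]
  rw [integral_complex_ofReal, ← Complex.ofReal_sub, Complex.ofReal_re, integral_const_mul,
    integral_const_mul, integral_finsetSum _ fun j _ => hwint n j, Finset.sum_sub_distrib]
  have hsame (j : ℕ) : ∫ ω, w n (X j ω) ∂P = ∫ ω, w n (X 0 ω) ∂P :=
    ((hident j).comp (hwmeas n)).integral_eq
  simp only [hsame]
  rcases n.eq_zero_or_pos with rfl | hn
  · simp
  have hsn : √(n : ℝ) ^ 2 = n := Real.sq_sqrt (Nat.cast_nonneg n)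
  have hsn0 : √(n : ℝ) ≠ 0 := (Real.sqrt_pos.2 (by exact_mod_cast hn)).ne'
  have hn0 : (n : ℝ) ≠ 0 := by exact_mod_cast hn.ne'
  have hinv : (√(n : ℝ))⁻¹ = √(n : ℝ) * (n : ℝ)⁻¹ := by
    field_simp
    exact hsn.symm
  have := (hcpos n).ne'
  rw [hinv]
  change _ = √(n : ℝ) / c n * _
  field_simp
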